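/- All graphs are finite and simple. A vertex cut of a graph $G$ is a set $S\subseteq V(G)$ such that $G-S$ is disconnected. The connectivity $\kappa(G)$ is $|V(G)|-1$ if $G$ is complete and the minimum size of a vertex cut of $G$ otherwise; $G$ is $2$-connected if $\kappa(G)\ge 2$. A bipartite graph is chordal bipartite if every cycle of length at least six has a chord, that is, an edge of the graph that is not an edge of the cycle but joins two vertices of the cycle. For $p,q\ge 1$ let $L(p,q)$ be the Cartesian product of a path on $p$ vertices and a path on $q$ vertices. Theorem. Let $n\ge 4$. Every $2$-connected chordal bipartite graph with $n$ vertices and $m$ edges satisfies $$m\ \ge\ \begin{cases}\dfrac{3n-3}{2} & \text{if } n \text{ is odd},\\[2mm] \dfrac{3n}{2}-2 & \text{if } n\text{ is even}.\end{cases}$$ Both bounds are tight: for every $n\ge 4$ there is a $2$-connected chordal bipartite graph with $n$ vertices for which equality holds. For even $n$, the ladder $L(2,n/2)$ is such a graph. For odd $n$, such a graph is obtained from the disjoint union of $K_{2,3}$ and the ladder $L(2,(n-3)/2)$ by identifying an edge of $K_{2,3}$ with the first rung of the ladder, i.e. with the edge joining the first vertices of its two paths on $(n-3)/2$ vertices.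 -/

import Mathlib

namespace SimpleGraph

/-- A set `S` of vertices is a vertex cut of `G` if the graph `G - S` is disconnected, i.e. has two
vertices which are not joined by a path of `G - S` (so the graph without vertices does not count as
disconnected). -/
def IsVertexCut {V : Type*} (G : SimpleGraph V) (S : Finset V) : Prop :=
  ¬ (G.induce {v | v ∉ S}).Preconnected

open Classical in
/-- The (vertex) connectivity `κ(G)` of a finite graph: `|V(G)| - 1` if `G` is complete, and
otherwise the minimum size of a vertex cut of `G`. A graph that is not complete has a vertex cut
(all vertices but two nonadjacent ones), so the infimum is then attained. -/
noncomputable def vertexConnectivity {V : Type*} (G : SimpleGraph V) : ℕ :=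
  if G = ⊤ then Nat.card V - 1 else sInf {k | ∃ S : Finset V, G.IsVertexCut S ∧ S.card = k}

/-- `G` is `k`-connected if `κ(G) ≥ k`. -/
def IsVertexKConnected {V : Type*} (G : SimpleGraph V) (k : ℕ) : Prop :=
  k ≤ G.vertexConnectivity

/-- A graph is chordal bipartite if it is bipartite and every cycle of length at least six has a
chord. -/
def IsChordalBipartite {V : Type*} (G : SimpleGraph V) : Prop :=
  G.IsBipartite ∧ ∀ (v : V) (c : G.Walk v v), c.IsCycle → 6 ≤ c.length → ∃ e, c.IsChord e

/-- The grid graph `L(p, q)`: the Cartesian product of the paths on `p` and on `q` vertices. -/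
def gridGraph (p q : ℕ) : SimpleGraph (Fin p × Fin q) :=
  pathGraph p □ pathGraph q

/-- The graph obtained from the disjoint union of `G` and `H` by identifying the edge `ab` of `G`
with the edge `cd` of `H`, where `c` is identified with `a` and `d` with `b`. The vertices are
those of `G` together with the vertices of `H` other than `c` and `d`. -/
def glueEdge {V W : Type*} (G : SimpleGraph V) (H : SimpleGraph W) {a b : V} {c d : W}
    (_hab : G.Adj a b) (_hcd : H.Adj c d) : SimpleGraph (V ⊕ {w : W // w ≠ c ∧ w ≠ d}) where
  Adj
    | .inl v, .inl v' => G.Adj v v'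
    | .inr w, .inr w' => H.Adj w w'
    | .inl v, .inr w => (v = a ∧ H.Adj c w) ∨ (v = b ∧ H.Adj d w)
    | .inr w, .inl v => (v = a ∧ H.Adj c w) ∨ (v = b ∧ H.Adj d w)
  symm := ⟨by
    rintro (v | w) (v' | w') h
    · exact G.adj_symm h
    · exact h
    · exact h
    · exact H.adj_symm h⟩
  loopless := ⟨by
    rintro (v | w) h
    · exact G.irrefl h
    · exact H.irrefl h⟩

/-- The two vertices of the first rung of the ladder `L(2, k)` are adjacent. -/
theorem gridGraph_two_adj_first_rung (k : ℕ) (hk : 0 < k) :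
    (gridGraph 2 k).Adj (0, ⟨0, hk⟩) (1, ⟨0, hk⟩) := by
  simp [gridGraph, boxProd_adj, pathGraph_adj]

/-- In `K_{2,3}` every vertex of the first side is adjacent to every vertex of the second side. -/
theorem completeBipartiteGraph_two_three_adj (i : Fin 2) (j : Fin 3) :
    (completeBipartiteGraph (Fin 2) (Fin 3)).Adj (.inl i) (.inr j) := by
  simp

/-- The ladder `L(2, k)`, `k ≥ 1`, with a copy of `K_{2,3}` glued along its first rung: an edge of
`K_{2,3}` is identified with the edge `(0,0)(1,0)` of the ladder. (Up to isomorphism, the choice of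
the edge of `K_{2,3}` and of its direction is immaterial.) -/
def ladderGlueK23 (k : ℕ) (hk : 0 < k) :=
  glueEdge (gridGraph 2 k) (completeBipartiteGraph (Fin 2) (Fin 3))
    (gridGraph_two_adj_first_rung k hk) (completeBipartiteGraph_two_three_adj 0 0)

end SimpleGraph

/-!
For the lower bound, start from one edge and repeatedly attach a four-cycle meeting the current
subgraph in an edge: each step brings in one new vertex with at least two edges, or two new
vertices with three edges, so `3n ≤ 2m + 4` is preserved. The subgraph `F` obtained in the end is
closed under four-cycles, and it is all of `G`: if `va` is an edge of `F` and `vb` one of `G`, a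
path from `a` to `b` avoiding `v` closes up to a cycle through `v`, which chords cut into
four-cycles, and so `vb` is in `F`.

The extremal graphs are built by gluing along edges. An edge is a clique separator, which no
chordless cycle crosses, so gluing preserves chordal bipartiteness; `2`-connectivity is seen from
a numbering of the vertices in which every vertex can descend to `s` and ascend to `t`.
-/

namespace ChordalBipartite

open SimpleGraph

variable {V W : Type*} {G : SimpleGraph V} {H : SimpleGraph W}

theorem length_le_card_support {v : V} [DecidableEq V] {c : G.Walk v v} (hc : c.IsCycle) :
    c.length ≤ c.support.toFinset.card := by
  calc c.length = c.support.tail.toFinset.card := by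
        rw [List.toFinset_card_of_nodup hc.support_nodup, List.length_tail, Walk.length_support,
          Nat.add_sub_cancel]
    _ ≤ c.support.toFinset.card := Finset.card_le_card fun z hz =>
        List.mem_toFinset.mpr (List.mem_of_mem_tail (List.mem_toFinset.mp hz))

theorem isChordless_map_iff (e : G ↪g H) {u v : V} {p : G.Walk u v} :
    (p.map e.toHom).IsChordless ↔ p.IsChordless := by
  have mem_edges_map (x y : V) : s(e x, e y) ∈ (p.map e.toHom).edges ↔ s(x, y) ∈ p.edges := by
    rw [Walk.edges_map, ← Sym2.map_mk]
    exact List.mem_map_of_injective (Sym2.map.injective e.injective)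
  simp only [Walk.isChordless_iff_forall_mem_edges, Walk.support_map, List.mem_map]
  constructor
  · intro h x y hx hy hxy
    exact (mem_edges_map x y).mp (h ⟨x, hx, rfl⟩ ⟨y, hy, rfl⟩ (e.map_adj_iff.mpr hxy))
  · rintro h _ _ ⟨x, hx, rfl⟩ ⟨y, hy, rfl⟩ hxy
    exact (mem_edges_map x y).mpr (h hx hy (e.map_adj_iff.mp hxy))

theorem isChordalBipartite_iff : G.IsChordalBipartite ↔ G.IsBipartite ∧
    ∀ (v : V) (c : G.Walk v v), c.IsCycle → c.IsChordless → c.length < 6 := by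
  refine and_congr_right fun _ => forall₃_congr fun v c _ => ?_
  rw [← not_imp_not, not_exists, not_le]
  rfl

theorem isChordalBipartite_of_embedding (e : G ↪g H) (hH : H.IsChordalBipartite) :
    G.IsChordalBipartite := by
  rw [isChordalBipartite_iff] at hH ⊢
  refine ⟨hH.1.of_hom e.toHom, fun v c hc hchord => ?_⟩
  simpa using hH.2 _ (c.map e.toHom) (hc.map e.injective) ((isChordless_map_iff e).mpr hchord)

/-! ### Clique separators -/

theorem eq_or_eq_of_mem_support_of_isCycle_append {x y z : V} {p : G.Walk x y} {q : G.Walk y x}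
    (hc : (p.append q).IsCycle) (hp : z ∈ p.support) (hq : z ∈ q.support) : z = x ∨ z = y := by
  have hnodup := hc.support_nodup
  rw [Walk.tail_support_append] at hnodup
  have hdisj := List.disjoint_of_nodup_append hnodup
  rw [Walk.mem_support_iff] at hp hq
  grind [List.Disjoint]

theorem exists_mem_support_inter {A B : Set V} (hsep : ∀ ⦃x y⦄, x ∉ B → G.Adj x y → y ∈ A)
    {x y : V} (p : G.Walk x y) (hx : x ∈ A) (hy : y ∉ A) : ∃ z ∈ p.support, z ∈ A ∩ B := by
  obtain ⟨d, hd, hfst, hsnd⟩ := p.exists_boundary_dart A hx hy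
  exact ⟨d.fst, p.dart_fst_mem_support_of_mem_darts hd, hfst,
    by_contra fun h => hsnd (hsep h d.adj)⟩

/-- The two arcs of the cycle between two separated vertices both meet the clique, in two vertices
that are not consecutive on the cycle. -/
theorem support_subset_or_of_isClique_inter {A B : Set V} (hcover : A ∪ B = Set.univ)
    (hsep : ∀ ⦃x y⦄, x ∉ B → G.Adj x y → y ∈ A) (hclique : G.IsClique (A ∩ B)) {v : V}
    {c : G.Walk v v} (hc : c.IsCycle) (hchord : c.IsChordless) :
    (∀ z ∈ c.support, z ∈ A) ∨ ∀ z ∈ c.support, z ∈ B := by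
  classical
  by_contra! ⟨⟨y, hyc, hyA⟩, x, hxc, hxB⟩
  have hxA : x ∈ A := (hcover.ge (Set.mem_univ x)).resolve_right hxB
  have hy : y ∈ (c.rotate x hxc).support := (c.mem_support_rotate_iff x hxc).mpr hyc
  set p := (c.rotate x hxc).takeUntil y hy
  set q := (c.rotate x hxc).dropUntil y hy
  have hpq : p.append q = c.rotate x hxc := Walk.take_spec _ hy
  have hcycle : (p.append q).IsCycle := hpq ▸ (Walk.isCycle_rotate hxc).mpr hc
  have ends {z : V} (hzp : z ∈ p.support) (hzq : z ∈ q.support) (hz : z ∈ A ∩ B) : False := by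
    rcases eq_or_eq_of_mem_support_of_isCycle_append hcycle hzp hzq with rfl | rfl
    exacts [hxB hz.2, hyA hz.1]
  have mem_support {z : V} (hz : z ∈ (p.append q).support) : z ∈ c.support := by
    rwa [hpq, Walk.mem_support_rotate_iff] at hz
  obtain ⟨u, hup, hu⟩ := exists_mem_support_inter hsep p hxA hyA
  obtain ⟨w, hwq, hw⟩ := exists_mem_support_inter hsep q.reverse hxA hyA
  rw [Walk.support_reverse, List.mem_reverse] at hwq
  have huw : G.Adj u w := hclique hu hw fun h => ends hup (h ▸ hwq) hu
  have hedge : s(u, w) ∈ (p.append q).edges := by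
    rw [hpq, (c.rotate_edges x hxc).mem_iff]
    exact hchord.mem_edges (mem_support (Walk.mem_support_append_iff .. |>.mpr (.inl hup)))
      (mem_support (Walk.mem_support_append_iff .. |>.mpr (.inr hwq))) huw
  rw [Walk.edges_append, List.mem_append] at hedge
  rcases hedge with h | h
  · exact ends (p.snd_mem_support_of_mem_edges h) hwq hw
  · exact ends hup (q.fst_mem_support_of_mem_edges h) hu

theorem isChordalBipartite_of_isClique_inter (hG : G.IsBipartite) {A B : Set V}
    (hcover : A ∪ B = Set.univ) (hsep : ∀ ⦃x y⦄, x ∉ B → G.Adj x y → y ∈ A)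
    (hclique : G.IsClique (A ∩ B)) (hA : (G.induce A).IsChordalBipartite)
    (hB : (G.induce B).IsChordalBipartite) : G.IsChordalBipartite := by
  refine isChordalBipartite_iff.mpr ⟨hG, fun v c hc hchord => ?_⟩
  have length_lt {S : Set V} (hS : (G.induce S).IsChordalBipartite)
      (hcS : ∀ z ∈ c.support, z ∈ S) : c.length < 6 := by
    have hmap := c.map_induce hcS
    have hlen : (c.induce S hcS).length = c.length :=
      (Walk.length_map _ _).symm.trans (congrArg Walk.length hmap)
    rw [← hmap] at hc hchord
    exact hlen ▸ (isChordalBipartite_iff.mp hS).2 _ _ hc.of_map ((isChordless_map_iff _).mp hchord)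
  exact (support_subset_or_of_isClique_inter hcover hsep hclique hc hchord).elim
    (length_lt hA) (length_lt hB)

theorem isChordalBipartite_of_card_lt_six [Finite V] (hG : G.IsBipartite) (hV : Nat.card V < 6) :
    G.IsChordalBipartite := by
  classical
  have := Fintype.ofFinite V
  refine isChordalBipartite_iff.mpr ⟨hG, fun v c hc _ => ?_⟩
  calc c.length ≤ c.support.toFinset.card := length_le_card_support hc
    _ ≤ Fintype.card V := Finset.card_le_univ _
    _ < 6 := by rwa [← Nat.card_eq_fintype_card]

/-- Every layer is a clique separator, so a chordless cycle meets only two consecutive layers, each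
in at most two vertices. -/
theorem isChordalBipartite_of_layers (hG : G.IsBipartite) (f : V → ℕ)
    (hadj : ∀ ⦃u v⦄, G.Adj u v → f v ≤ f u + 1) (hclique : ∀ j, G.IsClique {v | f v = j}) :
    G.IsChordalBipartite := by
  classical
  refine isChordalBipartite_iff.mpr ⟨hG, fun v c hc hchord => ?_⟩
  obtain ⟨x, hx, hmin⟩ := c.support.toFinset.exists_min_image f ⟨v, by simp⟩
  have hle : ∀ z ∈ c.support, f z ≤ f x + 1 := by
    refine (support_subset_or_of_isClique_inter (A := {v | f v ≤ f x + 1})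
      (B := {v | f x + 1 ≤ f v}) ?_ ?_ ?_ hc hchord).resolve_right fun h => ?_
    · exact Set.eq_univ_of_forall fun z => le_total (f z) (f x + 1)
    · intro z w (hz : ¬ f x + 1 ≤ f z) hzw
      exact (hadj hzw).trans (not_le.mp hz)
    · exact (hclique (f x + 1)).subset fun z hz => le_antisymm hz.1 hz.2
    · exact absurd (h x (List.mem_toFinset.mp hx)) (by simp)
  have card_layer (j : ℕ) : (c.support.toFinset.filter (f · = j)).card ≤ 2 :=
    ((hclique j).subset fun z hz => (Finset.mem_filter.mp hz).2).card_le_of_colorable hG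
  have hcover : c.support.toFinset ⊆
      c.support.toFinset.filter (f · = f x) ∪ c.support.toFinset.filter (f · = f x + 1) := by
    intro z hz
    have := hmin z hz
    have := hle z (List.mem_toFinset.mp hz)
    simp only [Finset.mem_union, Finset.mem_filter, hz, true_and]
    omega
  calc c.length ≤ c.support.toFinset.card := length_le_card_support hc
    _ ≤ 2 + 2 := (Finset.card_le_card hcover).trans <| (Finset.card_union_le _ _).trans <|
        add_le_add (card_layer _) (card_layer _)
    _ < 6 := by norm_num

/-! ### Vertex connectivity -/

theorem preconnected_induce_of_isVertexKConnected {k : ℕ} (hG : G.IsVertexKConnected k)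
    {S : Finset V} (hS : S.card < k) : (G.induce {v | v ∉ S}).Preconnected := by
  by_contra hcut
  rw [IsVertexKConnected, vertexConnectivity] at hG
  split_ifs at hG with htop
  · subst htop
    exact hcut (induce_top {v | v ∉ S} ▸ preconnected_top)
  · exact absurd (hG.trans (Nat.sInf_le ⟨S, hcut, rfl⟩)) (not_le.mpr hS)

theorem preconnected_of_isVertexKConnected {k : ℕ} (hk : 0 < k) (hG : G.IsVertexKConnected k) :
    G.Preconnected := by
  have h := preconnected_induce_of_isVertexKConnected hG (S := ∅) (by simpa using hk)
  exact fun x y => (h ⟨x, by simp⟩ ⟨y, by simp⟩).map (Embedding.induce _).toHom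

theorem nontrivial_of_isVertexKConnected {k : ℕ} (hk : 0 < k) (hG : G.IsVertexKConnected k) :
    Nontrivial V := by
  rw [← not_subsingleton_iff_nontrivial]
  intro _
  have htop : G = ⊤ := Subsingleton.elim _ _
  rw [IsVertexKConnected, vertexConnectivity, if_pos htop] at hG
  have : Nat.card V ≤ 1 := Finite.card_le_one_iff_subsingleton.mpr ‹_›
  omega

theorem exists_isVertexCut [Finite V] (hG : G ≠ ⊤) : ∃ S, G.IsVertexCut S := by
  obtain ⟨u, v, huv, hnadj⟩ := ne_top_iff_exists_not_adj.mp hG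
  refine ⟨(G.neighborSet u).toFinite.toFinset, fun hpre => ?_⟩
  let u' : {w | w ∉ (G.neighborSet u).toFinite.toFinset} := ⟨u, by simp⟩
  let v' : {w | w ∉ (G.neighborSet u).toFinite.toFinset} := ⟨v, by simpa using hnadj⟩
  have : Nontrivial {w | w ∉ (G.neighborSet u).toFinite.toFinset} :=
    ⟨u', v', fun h => huv (congrArg Subtype.val h)⟩
  obtain ⟨w, hw⟩ := hpre.exists_adj_of_nontrivial u'
  exact w.2 (by simpa using hw)

theorem isVertexKConnected_of_forall_preconnected [Finite V] {k : ℕ} (hk : k + 1 ≤ Nat.card V)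
    (h : ∀ S : Finset V, S.card < k → (G.induce {v | v ∉ S}).Preconnected) :
    G.IsVertexKConnected k := by
  rw [IsVertexKConnected, vertexConnectivity]
  split_ifs with htop
  · omega
  · obtain ⟨S, hS⟩ := exists_isVertexCut htop
    refine le_csInf ⟨_, S, hS, rfl⟩ ?_
    rintro _ ⟨T, hT, rfl⟩
    exact not_lt.mp fun hlt => hT (h T hlt)

theorem isVertexCut_map_iff (e : G ≃g H) {S : Finset V} :
    H.IsVertexCut (S.map e.toEquiv.toEmbedding) ↔ G.IsVertexCut S := by
  refine not_congr (Iso.preconnected_iff (e.induce ?_)).symm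
  refine ⟨fun v hv => ?_, e.injective.injOn, fun w hw => ⟨e.symm w, ?_, e.apply_symm_apply w⟩⟩
  · exact fun h => hv ((Finset.mem_map' _).mp h)
  · exact fun h => hw (Finset.mem_map.mpr ⟨_, h, e.apply_symm_apply w⟩)

theorem vertexConnectivity_congr (e : G ≃g H) : G.vertexConnectivity = H.vertexConnectivity := by
  have htop : G = ⊤ ↔ H = ⊤ := by
    simp only [eq_top_iff_forall_ne_adj, e.surjective.forall, e.map_adj_iff, e.injective.ne_iff]
  have hcut (k : ℕ) : (∃ S, G.IsVertexCut S ∧ S.card = k) ↔ ∃ S, H.IsVertexCut S ∧ S.card = k := by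
    constructor
    · rintro ⟨S, hS, rfl⟩
      exact ⟨_, (isVertexCut_map_iff e).mpr hS, S.card_map _⟩
    · rintro ⟨S, hS, rfl⟩
      exact ⟨_, (isVertexCut_map_iff e.symm).mpr hS, S.card_map _⟩
  unfold vertexConnectivity
  congr 1
  · exact propext htop
  · rw [Nat.card_congr e.toEquiv]
  · simp only [hcut]

/-- An `st`-numbering of `G` from `s` to `t`, as in the ear-decomposition literature, except that
distinct vertices may receive the same number. -/
structure IsSTNumbering {α : Type*} [Preorder α] (G : SimpleGraph V) (f : V → α) (s t : V) :
    Prop where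
  adj : G.Adj s t
  exists_lt : ∀ v ≠ s, ∃ u, G.Adj v u ∧ f u < f v
  exists_gt : ∀ v ≠ t, ∃ u, G.Adj v u ∧ f v < f u

section IsSTNumbering

variable {α : Type*} {f : V → α} {s t : V}

theorem IsSTNumbering.dual [Preorder α] (h : IsSTNumbering G f s t) :
    IsSTNumbering G (OrderDual.toDual ∘ f) t s :=
  ⟨h.adj.symm, h.exists_gt, h.exists_lt⟩

theorem IsSTNumbering.exists_reachable_of_forall_lt [Preorder α] [Finite V]
    (h : IsSTNumbering G f s t) {T : Set V} {x : V} (hx : x ∈ T) (hT : ∀ u, f u < f x → u ∈ T) :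
    ∃ hs : s ∈ T, (G.induce T).Reachable ⟨x, hx⟩ ⟨s, hs⟩ := by
  have hwf : WellFounded fun u v => f u < f v :=
    have : IsTrans V fun u v => f u < f v := ⟨fun _ _ _ => lt_trans⟩
    have : Std.Irrefl fun u v => f u < f v := ⟨fun _ => lt_irrefl _⟩
    Finite.wellFounded_of_trans_of_irrefl _
  induction x using hwf.induction with
  | _ x ih =>
    obtain rfl | hxs := eq_or_ne x s
    · exact ⟨hx, .rfl⟩
    · obtain ⟨u, hxu, hlt⟩ := h.exists_lt x hxs
      obtain ⟨hs, hus⟩ := ih u hlt (hT u hlt) fun w hw => hT w (hw.trans hlt)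
      exact ⟨hs, (Adj.reachable (induce_adj.mpr hxu)).trans hus⟩

/-- After deleting one vertex, every vertex below it still descends to `s`, every other one still
ascends to `t`, and `s` and `t` are adjacent. -/
theorem IsSTNumbering.isVertexKConnected_two [LinearOrder α] [Finite V]
    (h : IsSTNumbering G f s t) (hV : 3 ≤ Nat.card V) : G.IsVertexKConnected 2 := by
  refine isVertexKConnected_of_forall_preconnected hV fun S hS => ?_
  have : Nonempty V := ⟨s⟩
  obtain ⟨z, hz⟩ := Finset.card_le_one_iff_subset_singleton.mp (Nat.le_of_lt_succ hS)
  have mem_of_ne {u : V} (hu : u ≠ z) : u ∈ {v | v ∉ S} :=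
    fun h => hu (Finset.mem_singleton.mp (hz h))
  have reach (x : {v | v ∉ S}) :
      (∃ hs : s ∈ {v | v ∉ S}, (G.induce {v | v ∉ S}).Reachable x ⟨s, hs⟩) ∨
        ∃ ht : t ∈ {v | v ∉ S}, (G.induce {v | v ∉ S}).Reachable x ⟨t, ht⟩ := by
    rcases le_total (f x) (f z) with hxz | hzx
    · refine .inl (h.exists_reachable_of_forall_lt x.2 fun u hu => mem_of_ne ?_)
      rintro rfl
      exact hu.not_ge hxz
    · refine .inr (h.dual.exists_reachable_of_forall_lt x.2 fun u hu => mem_of_ne ?_)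
      rintro rfl
      exact hu.not_ge hzx
  intro x y
  rcases reach x with ⟨_, hxs⟩ | ⟨_, hxt⟩ <;> rcases reach y with ⟨_, hys⟩ | ⟨_, hyt⟩
  · exact hxs.trans hys.symm
  · exact (hxs.trans (Adj.reachable (induce_adj.mpr h.adj))).trans hyt.symm
  · exact (hxt.trans (Adj.reachable (induce_adj.mpr h.adj.symm))).trans hys.symm
  · exact hxt.trans hyt.symm

end IsSTNumbering

/-! ### Closure under four-cycles -/

/-- The edges of `F` are closed under the four-cycles of `G`: a four-cycle `abcd` of `G` with one
edge in `F` has all its edges in `F`. Only the edge `ad` next to `ab` is asked for, as the other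
two follow by going on around the cycle. -/
def FourCycleClosed (G F : SimpleGraph V) : Prop :=
  ∀ ⦃a b c d⦄, F.Adj a b → G.Adj b c → G.Adj c d → G.Adj d a → a ≠ c → b ≠ d → F.Adj a d

theorem two_le_length_of_adj_of_notMem_edges {x y : V} (p : G.Walk x y) (hxy : G.Adj x y)
    (he : s(x, y) ∉ p.edges) : 2 ≤ p.length := by
  match p with
  | .nil => exact absurd rfl hxy.ne
  | .cons _ .nil => simp at he
  | .cons _ (.cons _ _) => simp

theorem exists_shorter_walk {a b x y : V} (p : G.Walk a b) (hx : x ∈ p.support)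
    (hy : y ∈ p.support) (hxy : G.Adj x y) (he : s(x, y) ∉ p.edges) :
    ∃ q : G.Walk a b, q.length < p.length ∧ q.support ⊆ p.support := by
  have shortcut {x y : V} (q : G.Walk a x) (r : G.Walk x y) (t : G.Walk y b) (hxy : G.Adj x y)
      (he : s(x, y) ∉ r.edges) : ∃ w : G.Walk a b,
        w.length < (q.append (r.append t)).length ∧
          w.support ⊆ (q.append (r.append t)).support := by
    refine ⟨q.append (.cons hxy t), ?_, fun z hz => ?_⟩
    · have := two_le_length_of_adj_of_notMem_edges r hxy he
      simp only [Walk.length_append, Walk.length_cons]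
      omega
    · simp only [Walk.mem_support_append_iff, Walk.support_cons, List.mem_cons] at hz ⊢
      have := q.end_mem_support
      grind
  obtain ⟨q, r, rfl⟩ := Walk.mem_support_iff_exists_append.mp hx
  simp only [Walk.edges_append, List.mem_append, not_or] at he
  rcases (Walk.mem_support_append_iff _ _).mp hy with hy | hy
  · obtain ⟨q₁, q₂, rfl⟩ := Walk.mem_support_iff_exists_append.mp hy
    simp only [Walk.edges_append, List.mem_append, not_or] at he
    rw [← Walk.append_assoc]
    exact shortcut q₁ q₂ r hxy.symm (Sym2.eq_swap ▸ he.1.2)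
  · obtain ⟨r₁, r₂, rfl⟩ := Walk.mem_support_iff_exists_append.mp hy
    simp only [Walk.edges_append, List.mem_append, not_or] at he
    exact shortcut q r₁ r₂ hxy he.2.1

theorem isCycle_cons_concat {v a b : V} {p : G.Walk a b} (hp : p.IsPath) (hv : v ∉ p.support)
    (ha : G.Adj v a) (hb : G.Adj b v) (hab : a ≠ b) : (Walk.cons ha (p.concat hb)).IsCycle := by
  refine (Walk.cons_isCycle_iff _ _).mpr ⟨hp.concat hv hb, ?_⟩
  rw [Walk.edges_concat, List.concat_eq_append, List.mem_append, List.mem_singleton, not_or]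
  exact ⟨fun h => hv (p.fst_mem_support_of_mem_edges h), by simp [hab, hb.ne']⟩

theorem exists_spoke_or_shorter_walk (hG : G.IsChordalBipartite) {v a b : V} (p : G.Walk a b)
    (hv : v ∉ p.support) (ha : G.Adj v a) (hb : G.Adj v b) (hab : a ≠ b) (hlen : p.length ≠ 2) :
    (∃ z ∈ p.support, G.Adj v z ∧ z ≠ a ∧ z ≠ b) ∨
      ∃ q : G.Walk a b, q.length < p.length ∧ q.support ⊆ p.support := by
  classical
  by_cases hp : p.IsPath
  swap
  · refine .inr ⟨p.bypass, not_le.mp fun hle => hp ?_, p.support_bypass_subset_support⟩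
    exact p.bypass_eq_self_of_length_le_length_bypass hle ▸ p.bypass_isPath
  let c : G.Walk v v := .cons ha (p.concat hb.symm)
  have length_c : c.length = p.length + 2 := by simp [c]
  have support_c {z : V} (hz : z ∈ c.support) : z = v ∨ z ∈ p.support := by
    simp only [c, Walk.support_cons, Walk.support_concat] at hz
    grind
  have edges_c : c.edges = s(v, a) :: (p.edges ++ [s(b, v)]) := by simp [c, Walk.edges_concat]
  have six_le : 6 ≤ c.length := by
    obtain ⟨k, hk⟩ := two_colorable_iff_forall_loop_even.mp hG.1 v c
    have : p.length ≠ 0 := fun h => hab (Walk.eq_of_length_eq_zero h)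
    omega
  have spoke {z : V} (hz : z ∈ p.support) (hvz : G.Adj v z) (he : s(v, z) ∉ c.edges) :
      ∃ z ∈ p.support, G.Adj v z ∧ z ≠ a ∧ z ≠ b := by
    refine ⟨z, hz, hvz, ?_, ?_⟩ <;> rintro rfl <;> simp [edges_c] at he
  obtain ⟨⟨x, y⟩, hchord⟩ := hG.2 v c (isCycle_cons_concat hp hv ha hb.symm hab) six_le
  obtain ⟨hxy, he, hx, hy⟩ := Walk.isChord_sym2Mk.mp hchord
  rcases support_c hx with rfl | hxp <;> rcases support_c hy with rfl | hyp
  · exact absurd rfl hxy.ne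
  · exact .inl (spoke hyp hxy he)
  · exact .inl (spoke hxp hxy.symm (Sym2.eq_swap ▸ he))
  · exact .inr (exists_shorter_walk p hxp hyp hxy fun h => he (by simp [edges_c, h]))

/-- A spoke splits the cycle formed by `v` and the walk into two shorter ones; what remains in the
end are four-cycles. -/
theorem FourCycleClosed.adj_of_walk {F : SimpleGraph V} (hF : FourCycleClosed G F) (hFG : F ≤ G)
    (hG : G.IsChordalBipartite) {v a b : V} (p : G.Walk a b) (hv : v ∉ p.support)
    (ha : F.Adj v a) (hb : G.Adj v b) : F.Adj v b := by
  classical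
  induction hn : p.length using Nat.strong_induction_on generalizing a b with
  | _ n ih =>
  subst hn
  obtain rfl | hab := eq_or_ne a b
  · exact ha
  by_cases hlen : p.length = 2
  · match p with
    | .cons hax (.cons hxb .nil) => exact hF ha hax hxb hb.symm (by rintro rfl; simp at hv) hab
  rcases exists_spoke_or_shorter_walk hG p hv (hFG ha) hb hab hlen with
    ⟨z, hz, hvz, hza, hzb⟩ | ⟨q, hlt, hsub⟩
  · have hFz : F.Adj v z := ih _ (p.length_takeUntil_lt_length hz hzb) (p.takeUntil z hz)
      (fun h => hv (p.support_takeUntil_subset_support hz h)) ha hvz rfl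
    exact ih _ (p.length_dropUntil_lt_length hz hza) (p.dropUntil z hz)
      (fun h => hv (p.support_dropUntil_subset_support hz h)) hFz hb rfl
  · exact ih _ hlt q (fun h => hv (hsub h)) ha hb rfl

theorem FourCycleClosed.eq_of_isVertexKConnected_two {F : SimpleGraph V}
    (hF : FourCycleClosed G F) (hFG : F ≤ G) (hG : G.IsChordalBipartite)
    (h2 : G.IsVertexKConnected 2) (hne : F ≠ ⊥) : F = G := by
  have star {v a b : V} (ha : F.Adj v a) (hb : G.Adj v b) : F.Adj v b := by
    obtain ⟨p⟩ := preconnected_induce_of_isVertexKConnected h2 (S := {v}) (by simp)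
      ⟨a, by simpa using ha.ne'⟩ ⟨b, by simpa using hb.ne'⟩
    refine hF.adj_of_walk hFG hG (p.map (Embedding.induce _).toHom) ?_ ha hb
    intro hv
    obtain ⟨x, -, hx⟩ := List.mem_map.mp (Walk.support_map _ p ▸ hv)
    exact x.2 (Finset.mem_singleton.mpr hx)
  have support_eq (v : V) : v ∈ F.support := by
    by_contra hv
    obtain ⟨u, w, huw⟩ := ne_bot_iff_exists_adj.mp hne
    obtain ⟨p⟩ := preconnected_of_isVertexKConnected two_pos h2 u v
    obtain ⟨d, -, ⟨a, ha⟩, hsnd⟩ := p.exists_boundary_dart F.support huw.left_mem_support hv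
    exact hsnd (star ha d.adj).right_mem_support
  refine hFG.antisymm fun v b hb => ?_
  obtain ⟨a, ha⟩ := support_eq v
  exact star ha hb

/-- Attaching a four-cycle to an edge `ab` brings in one new vertex with at least two new edges, or
two new vertices with three new edges. -/
theorem three_mul_ncard_sdiff_support_le (F : SimpleGraph V) {a b c d : V} (hac : a ≠ c)
    (hbd : b ≠ d) (hab : a ≠ b) (hbc : b ≠ c) (hcd : c ≠ d) :
    3 * ({c, d} \ F.support).ncard ≤ 2 * ({s(b, c), s(c, d), s(d, a)} \ F.edgeSet).ncard := by
  have hbc_cd : s(b, c) ≠ s(c, d) := by simp [hbd, hbc]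
  have hbc_da : s(b, c) ≠ s(d, a) := by simp [hbd, hab.symm]
  have hcd_da : s(c, d) ≠ s(d, a) := by simp [hac.symm, hcd]
  set E : Set (Sym2 V) := {s(b, c), s(c, d), s(d, a)} \ F.edgeSet
  have hE : E.Finite := Set.toFinite _
  have notMem {x y : V} (h : x ∉ F.support ∨ y ∉ F.support) : s(x, y) ∉ F.edgeSet :=
    fun hxy : F.Adj x y => h.elim (· hxy.left_mem_support) (· hxy.right_mem_support)
  have hcdE (h : c ∉ F.support ∨ d ∉ F.support) : s(c, d) ∈ E := ⟨by simp, notMem h⟩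
  have hbcE (hc : c ∉ F.support) : s(b, c) ∈ E := ⟨by simp, notMem (.inr hc)⟩
  have hdaE (hd : d ∉ F.support) : s(d, a) ∈ E := ⟨by simp, notMem (.inl hd)⟩
  by_cases hc : c ∈ F.support <;> by_cases hd : d ∈ F.support
  · rw [Set.sdiff_eq_empty.mpr (Set.pair_subset hc hd), Set.ncard_empty]
    exact Nat.zero_le _
  · have hnew : ({c, d} : Set V) \ F.support = {d} := by
      rw [Set.insert_sdiff_of_mem _ hc, sdiff_eq_left.mpr (Set.disjoint_singleton_left.mpr hd)]
    have : 1 < E.ncard := (Set.one_lt_ncard_iff hE).mpr ⟨_, _, hcdE (.inr hd), hdaE hd, hcd_da⟩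
    rw [hnew, Set.ncard_singleton]
    omega
  · have hnew : ({c, d} : Set V) \ F.support = {c} := by
      rw [Set.pair_comm, Set.insert_sdiff_of_mem _ hd,
        sdiff_eq_left.mpr (Set.disjoint_singleton_left.mpr hc)]
    have : 1 < E.ncard := (Set.one_lt_ncard_iff hE).mpr ⟨_, _, hbcE hc, hcdE (.inl hc), hbc_cd⟩
    rw [hnew, Set.ncard_singleton]
    omega
  · have hnew : ({c, d} : Set V) \ F.support = {c, d} :=
      sdiff_eq_left.mpr (by simp [hc, hd])
    have : 2 < E.ncard := (Set.two_lt_ncard_iff hE).mpr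
      ⟨_, _, _, hbcE hc, hcdE (.inl hc), hdaE hd, hbc_cd, hbc_da, hcd_da⟩
    rw [hnew, Set.ncard_pair hcd]
    omega

theorem three_mul_ncard_support_sup_le [Finite V] (F : SimpleGraph V) {a b c d : V}
    (hab : F.Adj a b) (hac : a ≠ c) (hbd : b ≠ d) (hbc : b ≠ c) (hcd : c ≠ d) (hda : d ≠ a) :
    3 * (F ⊔ fromEdgeSet {s(b, c), s(c, d), s(d, a)}).support.ncard + 2 * F.edgeSet.ncard ≤
      3 * F.support.ncard + 2 * (F ⊔ fromEdgeSet {s(b, c), s(c, d), s(d, a)}).edgeSet.ncard := by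
  have hsupport : (F ⊔ fromEdgeSet {s(b, c), s(c, d), s(d, a)}).support ⊆ {c, d} ∪ F.support := by
    intro x hx
    obtain ⟨y, hxy⟩ := (mem_support _).mp hx
    have ha := hab.left_mem_support
    have hb := hab.right_mem_support
    rw [sup_adj, fromEdgeSet_adj] at hxy
    rcases hxy with hxy | ⟨hxy, -⟩
    · exact .inr hxy.left_mem_support
    · simp only [Set.mem_insert_iff, Set.mem_singleton_iff, Sym2.eq_iff] at hxy
      grind
  have hedges : (F ⊔ fromEdgeSet {s(b, c), s(c, d), s(d, a)}).edgeSet =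
      {s(b, c), s(c, d), s(d, a)} ∪ F.edgeSet := by
    rw [edgeSet_sup, edgeSet_fromEdgeSet, Set.union_comm, sdiff_eq_left.mpr]
    rw [Set.disjoint_left]
    rintro _ (rfl | rfl | rfl) <;> simpa
  have := three_mul_ncard_sdiff_support_le F hac hbd hab.ne hbc hcd
  have := Set.ncard_le_ncard hsupport
  have := Set.ncard_sdiff_add_ncard {c, d} F.support
  have := Set.ncard_sdiff_add_ncard {s(b, c), s(c, d), s(d, a)} F.edgeSet
  rw [hedges]
  omega

theorem exists_fourCycleClosed [Finite V] (hne : G ≠ ⊥) : ∃ F ≤ G, F ≠ ⊥ ∧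
    FourCycleClosed G F ∧ 3 * F.support.ncard ≤ 2 * F.edgeSet.ncard + 4 := by
  obtain ⟨u, v, huv⟩ := ne_bot_iff_exists_adj.mp hne
  have support_edge : (edge u v).support ⊆ {u, v} := by
    intro x hx
    obtain ⟨y, hxy⟩ := (mem_support _).mp hx
    rw [edge_adj] at hxy
    grind
  have ncard_support_edge : (edge u v).support.ncard ≤ 2 :=
    Set.ncard_pair huv.ne ▸ Set.ncard_le_ncard support_edge
  have ncard_edgeSet_edge : (edge u v).edgeSet.ncard = 1 := by
    rw [edgeSet_edge_of_ne huv.ne, Set.ncard_singleton]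
  obtain ⟨F, hle, ⟨hFG, hcard⟩, hmax⟩ := Finite.exists_le_maximal
    (p := fun F : SimpleGraph V => F ≤ G ∧ 3 * F.support.ncard ≤ 2 * F.edgeSet.ncard + 4)
    (a := edge u v) ⟨(edge_le_iff G).mpr (.inr huv), by omega⟩
  have huvF : F.Adj u v := hle (by simp [edge_adj, huv.ne])
  refine ⟨F, hFG, ne_bot_iff_exists_adj.mpr ⟨u, v, huvF⟩, ?_, hcard⟩
  intro a b c d hab hbc hcd hda hac hbd
  have hC : fromEdgeSet {s(b, c), s(c, d), s(d, a)} ≤ G := by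
    rw [fromEdgeSet_le]
    rintro _ ⟨rfl | rfl | rfl, -⟩ <;> assumption
  refine hmax ⟨sup_le hFG hC, ?_⟩ le_sup_left (.inr ?_)
  · have := three_mul_ncard_support_sup_le F hab hac hbd hbc.ne hcd.ne hda.ne
    omega
  · simp [hda.ne']

theorem three_mul_card_le [Finite V] (hG : G.IsChordalBipartite) (h2 : G.IsVertexKConnected 2) :
    3 * Nat.card V ≤ 2 * G.edgeSet.ncard + 4 := by
  have := nontrivial_of_isVertexKConnected two_pos h2
  have hpre := preconnected_of_isVertexKConnected two_pos h2
  have hG_ne : G ≠ ⊥ :=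
    ne_bot_iff_exists_adj.mpr ⟨_, hpre.exists_adj_of_nontrivial (Classical.arbitrary V)⟩
  obtain ⟨F, hFG, hne, hF, hcard⟩ := exists_fourCycleClosed hG_ne
  obtain rfl := hF.eq_of_isVertexKConnected_two hFG hG h2 hne
  rwa [hpre.support_eq_univ, Set.ncard_univ] at hcard

theorem three_mul_card_div_two_sub_two_le [Finite V] (hG : G.IsChordalBipartite)
    (h2 : G.IsVertexKConnected 2) : 3 * (Nat.card V : ℚ) / 2 - 2 ≤ G.edgeSet.ncard := by
  have h : 3 * (Nat.card V : ℚ) ≤ 2 * G.edgeSet.ncard + 4 := mod_cast three_mul_card_le hG h2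
  linarith

theorem three_mul_card_sub_three_div_two_le [Finite V] (hG : G.IsChordalBipartite)
    (h2 : G.IsVertexKConnected 2) (hodd : Odd (Nat.card V)) :
    (3 * (Nat.card V : ℚ) - 3) / 2 ≤ G.edgeSet.ncard := by
  have hparity : 3 * Nat.card V ≤ 2 * G.edgeSet.ncard + 3 := by grind [three_mul_card_le hG h2]
  have h : 3 * (Nat.card V : ℚ) ≤ 2 * G.edgeSet.ncard + 3 := mod_cast hparity
  linarith

/-! ### Gluing along an edge -/

section glueEdge

variable {a b : V} {c d : W} (hab : G.Adj a b) (hcd : H.Adj c d)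

open Classical in
/-- The copy of the second graph in `SimpleGraph.glueEdge`: the ends `c`, `d` of its glued edge are
sent to the ends `a`, `b` of the edge of the first graph. -/
noncomputable def glueInr (a b : V) (c d w : W) : V ⊕ {w : W // w ≠ c ∧ w ≠ d} :=
  if hc : w = c then .inl a else if hd : w = d then .inl b else .inr ⟨w, hc, hd⟩

theorem glueInr_left : glueInr a b c d c = .inl a := by
  simp [glueInr]

theorem glueInr_right (hcd : c ≠ d) : glueInr a b c d d = .inl b := by
  simp [glueInr, hcd.symm]

theorem glueInr_coe (w : {w : W // w ≠ c ∧ w ≠ d}) : glueInr a b c d w = .inr w := by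
  simp [glueInr, w.2.1, w.2.2]

theorem glueInr_injective (hab : a ≠ b) : Function.Injective (glueInr a b c d) := by
  intro x y h
  unfold glueInr at h
  grind

theorem glueEdge_adj_glueInr {x y : W} :
    (glueEdge G H hab hcd).Adj (glueInr a b c d x) (glueInr a b c d y) ↔ H.Adj x y := by
  simp only [glueInr]
  split_ifs with hxc hyc hyd hxd hyc hyd hyc hyd <;> subst_vars <;>
    simp [glueEdge, hab, hcd, hab.symm, hcd.symm, hab.ne, hab.ne', H.adj_comm]

/-- The first graph as an induced subgraph of `SimpleGraph.glueEdge`. -/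
def glueInlEmbedding : G ↪g glueEdge G H hab hcd where
  toFun := .inl
  inj' := Sum.inl_injective
  map_rel_iff' := .rfl

/-- The second graph as an induced subgraph of `SimpleGraph.glueEdge`. -/
noncomputable def glueInrEmbedding : H ↪g glueEdge G H hab hcd where
  toFun := glueInr a b c d
  inj' := glueInr_injective hab.ne
  map_rel_iff' := glueEdge_adj_glueInr hab hcd

theorem glueEdge_adj_cases {x y : V ⊕ {w : W // w ≠ c ∧ w ≠ d}}
    (h : (glueEdge G H hab hcd).Adj x y) :
    (∃ v v', G.Adj v v' ∧ .inl v = x ∧ .inl v' = y) ∨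
      ∃ w w', H.Adj w w' ∧ glueInr a b c d w = x ∧ glueInr a b c d w' = y := by
  rcases x with v | w <;> rcases y with v' | w'
  · exact .inl ⟨v, v', h, rfl, rfl⟩
  · rcases h with ⟨rfl, h⟩ | ⟨rfl, h⟩
    · exact .inr ⟨c, w', h, glueInr_left, glueInr_coe w'⟩
    · exact .inr ⟨d, w', h, glueInr_right hcd.ne, glueInr_coe w'⟩
  · rcases h with ⟨rfl, h⟩ | ⟨rfl, h⟩
    · exact .inr ⟨w, c, h.symm, glueInr_coe w, glueInr_left⟩
    · exact .inr ⟨w, d, h.symm, glueInr_coe w, glueInr_right hcd.ne⟩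
  · exact .inr ⟨w, w', h, glueInr_coe w, glueInr_coe w'⟩

theorem range_inl_inter_range_glueInr (hcd : c ≠ d) :
    Set.range Sum.inl ∩ Set.range (glueInr a b c d) = {Sum.inl a, Sum.inl b} := by
  ext z
  constructor
  · rintro ⟨⟨v, rfl⟩, w, hw⟩
    unfold glueInr at hw
    grind
  · rintro (rfl | rfl)
    exacts [⟨⟨a, rfl⟩, c, glueInr_left⟩, ⟨⟨b, rfl⟩, d, glueInr_right hcd⟩]

theorem sumElim_glueInr {α : Type*} {φ : V → α} {ψ : W → α} (hca : ψ c = φ a) (hdb : ψ d = φ b)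
    (w : W) : Sum.elim φ (fun w : {w // w ≠ c ∧ w ≠ d} => ψ w) (glueInr a b c d w) = ψ w := by
  unfold glueInr
  split_ifs with hc hd
  · exact hc ▸ hca.symm
  · exact hd ▸ hdb.symm
  · rfl

theorem isBipartite_glueEdge (hG : G.IsBipartite) (hH : H.IsBipartite) :
    (glueEdge G H hab hcd).IsBipartite := by
  obtain ⟨⟨C⟩, ⟨D⟩⟩ := And.intro hG hH
  let σ := Equiv.swap (D c) (C a)
  have hca : σ (D c) = C a := Equiv.swap_apply_left _ _
  have hdb : σ (D d) = C b := by
    have hC := C.valid hab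
    have hD := σ.injective.ne (D.valid hcd)
    omega
  refine ⟨Coloring.mk (Sum.elim C fun w => σ (D w)) fun {x y} h => ?_⟩
  rcases glueEdge_adj_cases hab hcd h with ⟨v, v', hv, rfl, rfl⟩ | ⟨w, w', hw, rfl, rfl⟩
  · exact C.valid hv
  · rw [sumElim_glueInr (ψ := fun w => σ (D w)) hca hdb,
      sumElim_glueInr (ψ := fun w => σ (D w)) hca hdb]
    exact σ.injective.ne (D.valid hw)

theorem isChordalBipartite_glueEdge (hG : G.IsChordalBipartite) (hH : H.IsChordalBipartite) :
    (glueEdge G H hab hcd).IsChordalBipartite := by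
  refine isChordalBipartite_of_isClique_inter (isBipartite_glueEdge hab hcd hG.1 hH.1)
    (A := Set.range (glueInlEmbedding hab hcd)) (B := Set.range (glueInrEmbedding hab hcd))
    ?_ ?_ ?_ (isChordalBipartite_of_embedding (Embedding.isoInduceRange _).symm.toEmbedding hG)
    (isChordalBipartite_of_embedding (Embedding.isoInduceRange _).symm.toEmbedding hH)
  · rw [Set.eq_univ_iff_forall]
    rintro (v | w)
    exacts [.inl ⟨v, rfl⟩, .inr ⟨w, glueInr_coe w⟩]
  · intro x y hx h
    rcases glueEdge_adj_cases hab hcd h with ⟨v, v', -, rfl, rfl⟩ | ⟨w, w', -, rfl, rfl⟩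
    exacts [⟨v', rfl⟩, absurd ⟨w, rfl⟩ hx]
  · have hinter := range_inl_inter_range_glueInr (a := a) (b := b) hcd.ne
    exact hinter ▸ isClique_pair.mpr fun _ => hab

theorem isSTNumbering_glueEdge {α : Type*} [Preorder α] {f : V → α} {g : W → α}
    (hf : IsSTNumbering G f a b) (hg : IsSTNumbering H g c d) (hca : g c = f a) (hdb : g d = f b) :
    IsSTNumbering (glueEdge G H hf.adj hg.adj) (Sum.elim f fun w => g w) (.inl a) (.inl b) where
  adj := hf.adj
  exists_lt := by
    rintro (v | w) hne
    · obtain ⟨u, hu, hlt⟩ := hf.exists_lt v fun h => hne (h ▸ rfl)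
      exact ⟨.inl u, hu, hlt⟩
    · obtain ⟨u, hu, hlt⟩ := hg.exists_lt w w.2.1
      refine ⟨glueInr a b c d u, ?_, (sumElim_glueInr hca hdb u).trans_lt hlt⟩
      exact glueInr_coe w ▸ (glueEdge_adj_glueInr _ _).mpr hu
  exists_gt := by
    rintro (v | w) hne
    · obtain ⟨u, hu, hlt⟩ := hf.exists_gt v fun h => hne (h ▸ rfl)
      exact ⟨.inl u, hu, hlt⟩
    · obtain ⟨u, hu, hlt⟩ := hg.exists_gt w w.2.2
      refine ⟨glueInr a b c d u, ?_, hlt.trans_eq (sumElim_glueInr hca hdb u).symm⟩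
      exact glueInr_coe w ▸ (glueEdge_adj_glueInr _ _).mpr hu

theorem edgeSet_glueEdge : (glueEdge G H hab hcd).edgeSet =
    Sym2.map .inl '' G.edgeSet ∪ Sym2.map (glueInr a b c d) '' H.edgeSet := by
  refine Set.Subset.antisymm (fun e he => ?_) (Set.union_subset ?_ ?_)
  · induction e with | _ x y
    rcases glueEdge_adj_cases hab hcd he with ⟨v, v', h, rfl, rfl⟩ | ⟨w, w', h, rfl, rfl⟩
    exacts [.inl ⟨s(v, v'), h, rfl⟩, .inr ⟨s(w, w'), h, rfl⟩]
  · rintro _ ⟨e, he, rfl⟩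
    exact (glueInlEmbedding hab hcd).map_mem_edgeSet_iff.mpr he
  · rintro _ ⟨e, he, rfl⟩
    exact (glueInrEmbedding hab hcd).map_mem_edgeSet_iff.mpr he

theorem ncard_edgeSet_glueEdge [Finite V] [Finite W] :
    (glueEdge G H hab hcd).edgeSet.ncard + 1 = G.edgeSet.ncard + H.edgeSet.ncard := by
  have hinter : Sym2.map Sum.inl '' G.edgeSet ∩ Sym2.map (glueInr a b c d) '' H.edgeSet =
      {s(Sum.inl a, Sum.inl b)} := by
    ext e
    constructor
    · rintro ⟨⟨e, he, rfl⟩, e', -, h⟩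
      induction e with | _ v v'
      have eq_or_eq {z : V} (hz : z ∈ s(v, v')) : z = a ∨ z = b := by
        obtain ⟨w, -, hw⟩ := Sym2.mem_map.mp (h ▸ Sym2.mem_map.mpr ⟨z, hz, rfl⟩)
        have hz' := (range_inl_inter_range_glueInr hcd.ne).subset ⟨⟨z, rfl⟩, w, hw⟩
        simpa using hz'
      have hne := he.ne
      rcases eq_or_eq (Sym2.mem_mk_left v v') with rfl | rfl <;>
        rcases eq_or_eq (Sym2.mem_mk_right v v') with rfl | rfl <;> simp_all
    · rintro rfl
      exact ⟨⟨s(a, b), hab, rfl⟩, s(c, d), hcd, by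
        simp [glueInr_left, glueInr_right hcd.ne]⟩
  have hG := Set.ncard_image_of_injective G.edgeSet
    (Sym2.map.injective (Sum.inl_injective (β := {w // w ≠ c ∧ w ≠ d})))
  have hH := Set.ncard_image_of_injective H.edgeSet
    (Sym2.map.injective (glueInr_injective (c := c) (d := d) hab.ne))
  rw [edgeSet_glueEdge, ← hG, ← hH, ← Set.ncard_union_add_ncard_inter, hinter,
    Set.ncard_singleton]

end glueEdge

/-! ### Ladders -/

theorem colorable_boxProd {n : ℕ} [NeZero n] (hG : G.Colorable n) (hH : H.Colorable n) :
    (G □ H).Colorable n := by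
  obtain ⟨⟨C⟩, ⟨D⟩⟩ := And.intro hG hH
  refine ⟨Coloring.mk (fun x => C x.1 + D x.2) fun {x y} h => ?_⟩
  rcases boxProd_adj.mp h with ⟨h, h₂⟩ | ⟨h, h₁⟩
  · rw [h₂, ne_eq, add_left_inj]
    exact C.valid h
  · rw [h₁, ne_eq, add_right_inj]
    exact D.valid h

theorem ncard_edgeSet_boxProd [Finite V] [Finite W] : (G □ H).edgeSet.ncard =
    G.edgeSet.ncard * Nat.card W + Nat.card V * H.edgeSet.ncard := by
  classical
  have := Fintype.ofFinite V
  have := Fintype.ofFinite W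
  have hdeg : 2 * (G □ H).edgeFinset.card =
      2 * (G.edgeFinset.card * Fintype.card W + Fintype.card V * H.edgeFinset.card) := by
    calc 2 * (G □ H).edgeFinset.card = ∑ v, ∑ w, (G.degree v + H.degree w) := by
          simp only [← sum_degrees_eq_twice_card_edges, Fintype.sum_prod_type, degree_boxProd]
      _ = (∑ v, G.degree v) * Fintype.card W + Fintype.card V * ∑ w, H.degree w := by
          simp [Finset.sum_add_distrib, ← Finset.mul_sum, mul_comm]
      _ = _ := by
          rw [sum_degrees_eq_twice_card_edges, sum_degrees_eq_twice_card_edges]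
          ring
  simpa only [← coe_edgeFinset, Set.ncard_coe_finset, Nat.card_eq_fintype_card] using
    Nat.eq_of_mul_eq_mul_left two_pos hdeg

theorem ncard_edgeSet_pathGraph_succ (n : ℕ) : (pathGraph (n + 1)).edgeSet.ncard = n := by
  have hrange : (pathGraph (n + 1)).edgeSet = Set.range fun i : Fin n => s(i.castSucc, i.succ) := by
    ext e
    induction e with | _ i j
    simp only [mem_edgeSet, pathGraph_adj, Set.mem_range, Sym2.eq_iff, Fin.ext_iff,
      Fin.val_castSucc, Fin.val_succ]
    constructor
    · rintro (h | h)
      · exact ⟨⟨i, by omega⟩, .inl ⟨rfl, h⟩⟩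
      · exact ⟨⟨j, by omega⟩, .inr ⟨rfl, h⟩⟩
    · rintro ⟨l, h | h⟩ <;> omega
  have hinj : Function.Injective fun i : Fin n => s(i.castSucc, i.succ) := by
    intro i j h
    simp only [Sym2.eq_iff, Fin.ext_iff, Fin.val_castSucc, Fin.val_succ] at h ⊢
    omega
  rw [hrange, ← Set.image_univ, Set.ncard_image_of_injective _ hinj, Set.ncard_univ, Nat.card_fin]

theorem ncard_edgeSet_gridGraph (p q : ℕ) :
    (gridGraph (p + 1) (q + 1)).edgeSet.ncard = p * (q + 1) + (p + 1) * q := by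
  rw [gridGraph, ncard_edgeSet_boxProd, ncard_edgeSet_pathGraph_succ,
    ncard_edgeSet_pathGraph_succ, Nat.card_fin, Nat.card_fin]

theorem isBipartite_gridGraph (p q : ℕ) : (gridGraph p q).IsBipartite :=
  have isBipartite_pathGraph (n : ℕ) : (pathGraph n).IsBipartite :=
    ((pathGraph.bicoloring n).colorable.mono (by simp))
  colorable_boxProd (isBipartite_pathGraph p) (isBipartite_pathGraph q)

theorem isChordalBipartite_gridGraph_two (k : ℕ) : (gridGraph 2 k).IsChordalBipartite := by
  refine isChordalBipartite_of_layers (isBipartite_gridGraph 2 k) (fun x => x.2) ?_ ?_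
  · intro x y h
    rcases boxProd_adj.mp h with ⟨-, h⟩ | ⟨h, -⟩
    · simp only [h, Nat.le_succ]
    · have := pathGraph_adj.mp h
      omega
  · intro j x hx y hy hxy
    have hcol : x.2 = y.2 := Fin.ext (hx.trans hy.symm)
    refine boxProd_adj.mpr (.inl ⟨?_, hcol⟩)
    rw [pathGraph_two_eq_top]
    exact fun h => hxy (Prod.ext h hcol)

/-- The numbering of the ladder that ascends along the first path and descends from `N` along the
second one. -/
def ladderNumbering (N : ℕ) {k : ℕ} (x : Fin 2 × Fin k) : ℕ :=
  if x.1 = 0 then x.2 else N - x.2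

theorem ladderNumbering_zero (N : ℕ) {k : ℕ} (j : Fin k) : ladderNumbering N (0, j) = j := rfl

theorem ladderNumbering_one (N : ℕ) {k : ℕ} (j : Fin k) : ladderNumbering N (1, j) = N - j := rfl

theorem isSTNumbering_ladderNumbering {N k : ℕ} (hN : 2 * k ≤ N) (hk : 0 < k) :
    IsSTNumbering (gridGraph 2 k) (ladderNumbering N) (0, ⟨0, hk⟩) (1, ⟨0, hk⟩) := by
  have rung (j : Fin k) : (gridGraph 2 k).Adj (0, j) (1, j) :=
    boxProd_adj.mpr (.inl ⟨pathGraph_adj.mpr (.inl rfl), rfl⟩)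
  have rung_lt (j : Fin k) : ladderNumbering N (0, j) < ladderNumbering N (1, j) := by
    rw [ladderNumbering_zero, ladderNumbering_one]
    omega
  have rail (i : Fin 2) (j : ℕ) (hj : j + 1 < k) :
      (gridGraph 2 k).Adj (i, ⟨j + 1, hj⟩) (i, ⟨j, by omega⟩) :=
    boxProd_adj.mpr (.inr ⟨pathGraph_adj.mpr (.inr rfl), rfl⟩)
  refine ⟨rung _, ?_, ?_⟩
  · rintro ⟨i, j⟩ hne
    fin_cases i
    · obtain ⟨_ | j, hj⟩ := j
      · exact absurd rfl hne
      · exact ⟨_, rail 0 j hj, Nat.lt_succ_self j⟩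
    · exact ⟨_, (rung j).symm, rung_lt j⟩
  · rintro ⟨i, j⟩ hne
    fin_cases i
    · exact ⟨_, rung j, rung_lt j⟩
    · obtain ⟨_ | j, hj⟩ := j
      · exact absurd rfl hne
      · exact ⟨_, rail 1 j hj, show N - (j + 1) < N - j by omega⟩

theorem isVertexKConnected_two_gridGraph_two {k : ℕ} (hk : 2 ≤ k) :
    (gridGraph 2 k).IsVertexKConnected 2 := by
  refine (isSTNumbering_ladderNumbering le_rfl (by omega)).isVertexKConnected_two ?_
  rw [Nat.card_prod, Nat.card_fin, Nat.card_fin]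
  omega

theorem cast_ncard_edgeSet_gridGraph_two {k : ℕ} (hk : 0 < k) :
    ((gridGraph 2 k).edgeSet.ncard : ℚ) = 3 * (2 * k : ℕ) / 2 - 2 := by
  obtain ⟨k, rfl⟩ := Nat.exists_eq_succ_of_ne_zero hk.ne'
  rw [ncard_edgeSet_gridGraph 1 k]
  push_cast
  ring

/-! ### The ladder glued to `K_{2,3}` -/

theorem isBipartite_completeBipartiteGraph (V W : Type*) :
    (completeBipartiteGraph V W).IsBipartite :=
  (CompleteBipartiteGraph.bicoloring V W).colorable.mono (by simp)

theorem isChordalBipartite_completeBipartiteGraph_two_three :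
    (completeBipartiteGraph (Fin 2) (Fin 3)).IsChordalBipartite :=
  isChordalBipartite_of_card_lt_six (isBipartite_completeBipartiteGraph _ _) (by simp)

theorem ncard_edgeSet_completeBipartiteGraph (V W : Type*) [Finite V] [Finite W] :
    (completeBipartiteGraph V W).edgeSet.ncard = Nat.card V * Nat.card W := by
  have h := encard_edgeSet_completeBipartiteGraph (W₁ := V) (W₂ := W)
  rw [← Set.Finite.cast_ncard_eq (Set.toFinite _), ENat.card_eq_coe_natCard,
    ENat.card_eq_coe_natCard] at h
  exact_mod_cast h

theorem isSTNumbering_completeBipartiteGraph_two_three {N : ℕ} (hN : 2 < N) :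
    IsSTNumbering (completeBipartiteGraph (Fin 2) (Fin 3)) (Sum.elim ![0, 2] ![N, 1, 1])
      (.inl 0) (.inr 0) := by
  have hpos : 0 < N := by omega
  refine ⟨completeBipartiteGraph_two_three_adj 0 0, ?_, ?_⟩
  · rintro (i | j) hne
    · exact ⟨.inr 1, by simp, by fin_cases i <;> simp_all⟩
    · exact ⟨.inl 0, by simp, by fin_cases j <;> simp [hpos]⟩
  · rintro (i | j) hne
    · exact ⟨.inr 0, by simp, by fin_cases i <;> simp [hpos, hN]⟩
    · exact ⟨.inl 1, by simp, by fin_cases j <;> simp_all⟩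

section ladderGlueK23

variable (k : ℕ) (hk : 0 < k)

theorem natCard_ladderGlueK23 :
    Nat.card ((Fin 2 × Fin k) ⊕ {w : Fin 2 ⊕ Fin 3 // w ≠ Sum.inl 0 ∧ w ≠ Sum.inr 0}) =
      2 * k + 3 := by
  have : Fintype.card {w : Fin 2 ⊕ Fin 3 // w ≠ Sum.inl 0 ∧ w ≠ Sum.inr 0} = 3 := rfl
  simp [this]

theorem isChordalBipartite_ladderGlueK23 : (ladderGlueK23 k hk).IsChordalBipartite :=
  isChordalBipartite_glueEdge _ _ (isChordalBipartite_gridGraph_two k)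
    isChordalBipartite_completeBipartiteGraph_two_three

theorem isVertexKConnected_two_ladderGlueK23 : (ladderGlueK23 k hk).IsVertexKConnected 2 := by
  refine (isSTNumbering_glueEdge
    (isSTNumbering_ladderNumbering (N := 2 * k + 3) (Nat.le_add_right _ _) hk)
    (isSTNumbering_completeBipartiteGraph_two_three (N := 2 * k + 3) (by omega))
    rfl rfl).isVertexKConnected_two ?_
  rw [natCard_ladderGlueK23]
  omega

theorem ncard_edgeSet_ladderGlueK23 : (ladderGlueK23 k hk).edgeSet.ncard = 3 * k + 3 := by
  obtain ⟨k, rfl⟩ := Nat.exists_eq_succ_of_ne_zero hk.ne'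
  have h : (ladderGlueK23 (k + 1) hk).edgeSet.ncard + 1 = _ := ncard_edgeSet_glueEdge _ _
  rw [ncard_edgeSet_gridGraph 1 k, ncard_edgeSet_completeBipartiteGraph, Nat.card_fin,
    Nat.card_fin] at h
  lia

theorem cast_ncard_edgeSet_ladderGlueK23 :
    ((ladderGlueK23 k hk).edgeSet.ncard : ℚ) = (3 * (2 * k + 3 : ℕ) - 3) / 2 := by
  rw [ncard_edgeSet_ladderGlueK23]
  push_cast
  ring

end ladderGlueK23

/-! ### Graphs of a given order -/

theorem exists_graph_fin_of_natCard_eq [Finite V] {n k : ℕ} (hV : Nat.card V = n)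
    (h2 : G.IsVertexKConnected k) (hG : G.IsChordalBipartite) :
    ∃ G' : SimpleGraph (Fin n), G'.IsVertexKConnected k ∧ G'.IsChordalBipartite ∧
      G'.edgeSet.ncard = G.edgeSet.ncard := by
  let e := Iso.map (Finite.equivFinOfCardEq hV) G
  refine ⟨_, h2.trans_eq (vertexConnectivity_congr e),
    isChordalBipartite_of_embedding e.symm.toEmbedding hG, ?_⟩
  rw [← Nat.card_coe_set_eq, ← Nat.card_coe_set_eq, Nat.card_congr e.mapEdgeSet]

end ChordalBipartite

theorem theorem1p1 (n : ℕ) (hn : 4 ≤ n) :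
    -- the lower bounds
    (∀ (V : Type*) [Finite V] (G : SimpleGraph V), Nat.card V = n →
      G.IsVertexKConnected 2 → G.IsChordalBipartite →
        (Odd n → (3 * (n : ℚ) - 3) / 2 ≤ (G.edgeSet.ncard : ℚ)) ∧
        (Even n → 3 * (n : ℚ) / 2 - 2 ≤ (G.edgeSet.ncard : ℚ))) ∧
    -- both bounds are tight for every order
    (Odd n → ∃ G : SimpleGraph (Fin n), G.IsVertexKConnected 2 ∧ G.IsChordalBipartite ∧
      (G.edgeSet.ncard : ℚ) = (3 * (n : ℚ) - 3) / 2) ∧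
    (Even n → ∃ G : SimpleGraph (Fin n), G.IsVertexKConnected 2 ∧ G.IsChordalBipartite ∧
      (G.edgeSet.ncard : ℚ) = 3 * (n : ℚ) / 2 - 2) ∧
    -- the ladder attains the bound for even order
    (∀ k : ℕ, n = 2 * k →
      Nat.card (Fin 2 × Fin k) = n ∧
      (SimpleGraph.gridGraph 2 k).IsVertexKConnected 2 ∧
      (SimpleGraph.gridGraph 2 k).IsChordalBipartite ∧
      ((SimpleGraph.gridGraph 2 k).edgeSet.ncard : ℚ) = 3 * (n : ℚ) / 2 - 2) ∧
    -- the ladder glued to `K_{2,3}` along an edge attains the bound for odd order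
    (∀ (k : ℕ) (hk : 0 < k), n = 2 * k + 3 →
      Nat.card ((Fin 2 × Fin k) ⊕
        {w : Fin 2 ⊕ Fin 3 // w ≠ Sum.inl 0 ∧ w ≠ Sum.inr 0}) = n ∧
      (SimpleGraph.ladderGlueK23 k hk).IsVertexKConnected 2 ∧
      (SimpleGraph.ladderGlueK23 k hk).IsChordalBipartite ∧
      ((SimpleGraph.ladderGlueK23 k hk).edgeSet.ncard : ℚ) = (3 * (n : ℚ) - 3) / 2) := by
  open ChordalBipartite in
  refine ⟨fun V _ G hV h2 hG => ?_, fun hodd => ?_, fun heven => ?_, ?_, fun k hk hn' => ?_⟩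
  · subst hV
    exact ⟨three_mul_card_sub_three_div_two_le hG h2, fun _ =>
      three_mul_card_div_two_sub_two_le hG h2⟩
  · obtain ⟨k, hk, rfl⟩ : ∃ k, 0 < k ∧ n = 2 * k + 3 := ⟨(n - 3) / 2, by grind, by grind⟩
    obtain ⟨G, h2, hG, hm⟩ := exists_graph_fin_of_natCard_eq (natCard_ladderGlueK23 k)
      (isVertexKConnected_two_ladderGlueK23 k hk) (isChordalBipartite_ladderGlueK23 k hk)
    exact ⟨G, h2, hG, hm ▸ cast_ncard_edgeSet_ladderGlueK23 k hk⟩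
  · obtain ⟨k, rfl⟩ := even_iff_exists_two_mul.mp heven
    obtain ⟨G, h2, hG, hm⟩ := exists_graph_fin_of_natCard_eq (n := 2 * k) (by simp)
      (isVertexKConnected_two_gridGraph_two (by omega)) (isChordalBipartite_gridGraph_two k)
    exact ⟨G, h2, hG, hm ▸ cast_ncard_edgeSet_gridGraph_two (by omega)⟩
  · rintro k rfl
    exact ⟨by simp, isVertexKConnected_two_gridGraph_two (by omega),
      isChordalBipartite_gridGraph_two k, cast_ncard_edgeSet_gridGraph_two (by omega)⟩
  · subst hn'
    exact ⟨natCard_ladderGlueK23 k, isVertexKConnected_two_ladderGlueK23 k hk,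
      isChordalBipartite_ladderGlueK23 k hk, cast_ncard_edgeSet_ladderGlueK23 k hk⟩
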